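/- A real polynomial is called hyperbolic if all its roots are real (constants, including $0$, count as hyperbolic). A sequence $\mathcal A=(\alpha_n)_{n\ge 0}$ of real numbers is a multiplier sequence if the linear operator on $\mathbb R[x]$ given by $x^i\mapsto \alpha_i x^i$ for all $i\ge 0$ sends every hyperbolic polynomial to a hyperbolic polynomial. For a polynomial $P$ all of whose nonzero roots are real and of the same sign, order its roots, with multiplicity, as $|x_1|\le |x_2|\le\dots\le |x_m|$, and define its logarithmic mesh as $$\operatorname{lmesh}(P)=\min_{1\le j\le m-1,\ x_j\ne 0}\frac{|x_{j+1}|}{|x_j|}\in[1,+\infty],$$ where the minimum over the empty set is $+\infty$ (in particular $\operatorname{lmesh}(0)=+\infty$). For a multiplier sequence $\mathcal A=(\alpha_n)_{n\ge0}$ and $k\ge 0$ let $\mathcal A_k=(\alpha_0,\dots,\alpha_k)$ be its $k$-th truncation, and let $\operatorname{lmesh}(\mathcal A_k)$ be the logarithmic mesh of the polynomial $\sum_{j=0}^k\binom kj\alpha_j t^j$. Put $$\operatorname{lmesh}(\mathcal A)=\inf_{k\ge 0}\operatorname{lmesh}(\mathcal A_k).$$ Then for any multiplier sequences $\mathcal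 A=(\alpha_n)_{n\ge 0}$ and $\mathcal B=(\beta_n)_{n\ge 0}$, the termwise product $\mathcal A\mathcal B=(\alpha_n\beta_n)_{n\ge 0}$ satisfies $$\operatorname{lmesh}(\mathcal A\mathcal B)\ge\max\bigl(\operatorname{lmesh}(\mathcal A),\operatorname{lmesh}(\mathcal B)\bigr).$$ -/

import Mathlib

open Polynomial

noncomputable section

namespace LogMesh

/-- A real polynomial is hyperbolic if all its complex roots are real, i.e. if it is a product of
linear factors and a constant over `ℝ`. Constants, including `0`, are hyperbolic. -/
def IsHyperbolic (p : ℝ[X]) : Prop := p.Splits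

/-- The linear operator on `ℝ[X]` that acts on the monomial basis by `X ^ i ↦ α i • X ^ i`. -/
def diagonalOperator (α : ℕ → ℝ) : ℝ[X] →ₗ[ℝ] ℝ[X] :=
  Polynomial.lsum fun i => α i • (Polynomial.monomial i : ℝ →ₗ[ℝ] ℝ[X])

theorem diagonalOperator_X_pow (α : ℕ → ℝ) (i : ℕ) :
    diagonalOperator α (X ^ i) = α i • X ^ i := by
  simp [diagonalOperator, Polynomial.lsum_apply, X_pow_eq_monomial, sum_monomial_index]

/-- Multiplier sequences (of the first kind): the diagonal operator preserves the set of
hyperbolic polynomials. -/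
def IsMultiplierSequence (α : ℕ → ℝ) : Prop :=
  ∀ p : ℝ[X], IsHyperbolic p → IsHyperbolic (diagonalOperator α p)

/-- The absolute values `|x₁| ≤ |x₂| ≤ …` of the real roots of `P`, listed with multiplicity in
nondecreasing order. -/
def absRoots (P : ℝ[X]) : List ℝ := (P.roots.map fun x => |x|).sort (· ≤ ·)

/-- The minimum of the quotients `y_{j+1} / y_j` of consecutive entries of a list. Quotients with
`y_j = 0` are left out; the minimum over the empty set is `⊤ = +∞`. -/
def minQuotient (L : List ℝ) : EReal :=
  ⨅ (j : ℕ) (h : j + 1 < L.length) (_ : L[j] ≠ 0), ((L[j + 1] / L[j] : ℝ) : EReal)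

/-- The logarithmic mesh of a polynomial whose roots are real and of the same sign: the minimum
of the quotients `|x_{j+1}| / |x_j|` of consecutive roots. -/
def lmesh (P : ℝ[X]) : EReal := minQuotient (absRoots P)

/-- The polynomial `∑ j, (k choose j) γ_j t ^ j` identified with the finite sequence
`γ_0, …, γ_k`; it is the image of `(1 + t) ^ k` under the diagonal operator of `γ`. -/
def finitePoly {k : ℕ} (γ : Fin (k + 1) → ℝ) : ℝ[X] :=
  ∑ j : Fin (k + 1), C ((k.choose j : ℝ) * γ j) * X ^ (j : ℕ)

/-- The logarithmic mesh of a finite multiplier sequence of length `k + 1`. -/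
def lmeshFinite {k : ℕ} (γ : Fin (k + 1) → ℝ) : EReal := lmesh (finitePoly γ)

/-- The `k`-th truncation of `α`: its initial segment of length `k + 1`. -/
def truncation (α : ℕ → ℝ) (k : ℕ) : Fin (k + 1) → ℝ := fun j => α j

/-- The logarithmic mesh of an infinite multiplier sequence. -/
def lmeshSeq (α : ℕ → ℝ) : EReal := ⨅ k : ℕ, lmeshFinite (truncation α k)

end LogMesh

end

/-!
A bound `q ≤ lmesh P`, for a hyperbolic `P` whose nonzero roots have one sign, is equivalent to the
hyperbolicity of all pencils `P(x) + c P(rx)` with `1 < r < q` and `c` real. A diagonal operator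
commutes with the dilations `x ↦ rx`, so a multiplier sequence maps the pencils of `P` to those of
the image of `P` and cannot decrease the logarithmic mesh.

If the roots are separated by more than the factor `r`, the pencil alternates in sign along the
roots of `P`, which makes it hyperbolic. Conversely, if all combinations `F + c G` are hyperbolic,
the Laguerre inequality rules out a double zero of a nonzero combination off the zeros of `G`, so
Rolle's theorem applied to `F / G` shows that `G` has a root between any two roots of `F`; for
`G(x) = F(rx)` a descent along the ordered roots yields the separation. All the polynomials involved
have roots of one sign because the signs of a multiplier sequence are those of a geometric
progression.
-/

namespace LogMesh

section Laguerre

/-- The Laguerre expression of `p`. It is `-p ^ 2` times the second derivative of `log p`, so for a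
product of linear factors `x - r` it is `p ^ 2` times the sum of the `(x - r)⁻¹ ^ 2`. -/
noncomputable def laguerre {R : Type*} [CommRing R] (p : R[X]) : R[X] :=
  derivative p ^ 2 - p * derivative (derivative p)

theorem laguerre_C {R : Type*} [CommRing R] (a : R) : laguerre (C a) = 0 := by
  simp [laguerre]

theorem laguerre_X_sub_C {R : Type*} [CommRing R] (a : R) : laguerre (X - C a) = 1 := by
  simp [laguerre]

theorem laguerre_mul {R : Type*} [CommRing R] (p q : R[X]) :
    laguerre (p * q) = laguerre p * q ^ 2 + p ^ 2 * laguerre q := by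
  simp only [laguerre, derivative_mul, derivative_add]
  ring

theorem sub_ne_zero_of_mem_roots {R : Type*} [CommRing R] [IsDomain R] {p : R[X]} {r t : R}
    (ht : p.eval t ≠ 0) (hr : r ∈ p.roots) : t - r ≠ 0 := by
  rw [sub_ne_zero]
  rintro rfl
  exact ht (isRoot_of_mem_roots hr)

theorem eval_laguerre_prod_X_sub_C {K : Type*} [Field K] {s : Multiset K} {t : K}
    (hs : ∀ r ∈ s, t - r ≠ 0) :
    (laguerre (s.map fun r => X - C r).prod).eval t =
      (s.map fun r => X - C r).prod.eval t ^ 2 * (s.map fun r => (t - r)⁻¹ ^ 2).sum := by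
  induction s using Multiset.induction_on with
  | empty => simp [laguerre]
  | cons a s ih =>
    have ha : t - a ≠ 0 := hs a (Multiset.mem_cons_self a s)
    simp only [Multiset.map_cons, Multiset.prod_cons, Multiset.sum_cons, laguerre_mul,
      laguerre_X_sub_C, eval_add, eval_mul, eval_pow, eval_sub, eval_X, eval_C, eval_one,
      ih fun r hr => hs r (Multiset.mem_cons_of_mem hr)]
    field_simp

theorem eval_laguerre_eq_sq_mul_sum_roots {K : Type*} [Field K] {p : K[X]} (hp : p.Splits) {t : K}
    (ht : p.eval t ≠ 0) :
    (laguerre p).eval t = p.eval t ^ 2 * (p.roots.map fun r => (t - r)⁻¹ ^ 2).sum := by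
  have hroots := eval_laguerre_prod_X_sub_C fun r hr => sub_ne_zero_of_mem_roots ht hr
  set q := (p.roots.map fun r => X - C r).prod
  have hpq : p = C p.leadingCoeff * q := hp.eq_prod_roots
  calc (laguerre p).eval t = (laguerre (C p.leadingCoeff * q)).eval t := by rw [← hpq]
    _ = (p.leadingCoeff * q.eval t) ^ 2 * (p.roots.map fun r => (t - r)⁻¹ ^ 2).sum := by
      simp only [laguerre_mul, laguerre_C, zero_mul, zero_add, eval_mul, eval_pow, eval_C, hroots]
      ring
    _ = p.eval t ^ 2 * (p.roots.map fun r => (t - r)⁻¹ ^ 2).sum := by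
      rw [← eval_C_mul, ← hpq]

variable {K : Type*} [Field K] [LinearOrder K] [IsStrictOrderedRing K]

theorem sq_eval_mul_sq_inv_sub_le_eval_laguerre {p : K[X]} (hp : p.Splits) {r t : K}
    (ht : p.eval t ≠ 0) (hr : r ∈ p.roots) :
    p.eval t ^ 2 * (t - r)⁻¹ ^ 2 ≤ (laguerre p).eval t := by
  rw [eval_laguerre_eq_sq_mul_sum_roots hp ht]
  refine mul_le_mul_of_nonneg_left (Multiset.single_le_sum ?_ _
    (Multiset.mem_map_of_mem (fun r => (t - r)⁻¹ ^ 2) hr)) (sq_nonneg _)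
  simp only [Multiset.mem_map, forall_exists_index, and_imp, forall_apply_eq_imp_iff₂]
  exact fun _ _ => sq_nonneg _

theorem natDegree_eq_zero_of_eval_laguerre_nonpos {p : K[X]} (hp : p.Splits) {t : K}
    (ht : p.eval t ≠ 0) (h : (laguerre p).eval t ≤ 0) : p.natDegree = 0 := by
  rw [hp.natDegree_eq_card_roots, Multiset.card_eq_zero]
  refine Multiset.eq_zero_of_forall_notMem fun r hr => h.not_gt ?_
  have htr := sub_ne_zero_of_mem_roots ht hr
  exact lt_of_lt_of_le (by positivity) (sq_eval_mul_sq_inv_sub_le_eval_laguerre hp ht hr)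

theorem natDegree_eq_zero_of_coeff_zero_mul_coeff_two_nonneg {p : K[X]} (hp : p.Splits)
    (h0 : p.coeff 0 ≠ 0) (h1 : p.coeff 1 = 0) (h2 : 0 ≤ p.coeff 0 * p.coeff 2) :
    p.natDegree = 0 := by
  have hlaguerre : (laguerre p).eval 0 = -(2 * (p.coeff 0 * p.coeff 2)) := by
    simp only [laguerre, eval_sub, eval_mul, eval_pow, ← coeff_zero_eq_eval_zero, coeff_derivative]
    norm_num [h1]
    ring
  exact natDegree_eq_zero_of_eval_laguerre_nonpos hp (coeff_zero_eq_eval_zero p ▸ h0)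
    (by linarith)

theorem abs_sub_le_mul_of_eval_laguerre_le {p : K[X]} (hp : p.Splits) {r t M : K}
    (ht : p.eval t ≠ 0) (hM : 0 ≤ M) (h : (laguerre p).eval t ≤ p.eval t ^ 2 * M ^ 2)
    (hr : r ∈ p.roots) (s : K) : |s - r| ≤ |t - r| * (1 + |s - t| * M) := by
  have htr : 0 < |t - r| := abs_pos.2 (sub_ne_zero_of_mem_roots ht hr)
  have hinv : |t - r|⁻¹ ≤ M := by
    rw [← abs_inv]
    exact abs_le_of_sq_le_sq (le_of_mul_le_mul_left
      ((sq_eval_mul_sq_inv_sub_le_eval_laguerre hp ht hr).trans h) (by positivity)) hM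
  have hone : 1 ≤ |t - r| * M := by rwa [← inv_le_iff_one_le_mul₀' htr]
  calc |s - r| ≤ |s - t| + |t - r| := abs_sub_le s t r
    _ ≤ |s - t| * (|t - r| * M) + |t - r| := by
        gcongr
        exact le_mul_of_one_le_right (abs_nonneg _) hone
    _ = |t - r| * (1 + |s - t| * M) := by ring

theorem abs_eval_le_of_eval_laguerre_le {p : K[X]} (hp : p.Splits) {t M : K}
    (ht : p.eval t ≠ 0) (hM : 0 ≤ M) (h : (laguerre p).eval t ≤ p.eval t ^ 2 * M ^ 2) (s : K) :
    |p.eval s| ≤ |p.eval t| * (1 + |s - t| * M) ^ p.natDegree := by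
  have habs : ∀ x, |p.eval x| = |p.leadingCoeff| * (p.roots.map fun r => |x - r|).prod := by
    intro x
    rw [hp.eval_eq_prod_roots x, abs_mul]
    congr 1
    exact (map_multiset_prod (absHom : K →*₀ K) _).trans (congrArg _ (Multiset.map_map _ _ _))
  rw [habs s, habs t, mul_assoc, hp.natDegree_eq_card_roots, ← Multiset.prod_replicate,
    ← Multiset.map_const', ← Multiset.prod_map_mul]
  gcongr
  exact Multiset.prod_map_le_prod_map₀ _ _ (fun _ _ => abs_nonneg _)
    fun r hr => abs_sub_le_mul_of_eval_laguerre_le hp ht hM h hr s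

end Laguerre

section Pencil

theorem abs_eval_add_C_mul_le_of_double_root {K : Type*} [Field K] [LinearOrder K]
    [IsStrictOrderedRing K] {F D : K[X]} {δ t M : K} (hδ : 0 < δ)
    (hsplits : (D + C δ * F).Splits) (hD : D.eval t = 0) (hD' : (derivative D).eval t = 0)
    (hF : F.eval t ≠ 0) (hFD : 0 ≤ F.eval t * (derivative (derivative D)).eval t) (hM : 0 ≤ M)
    (hFM : (laguerre F).eval t ≤ F.eval t ^ 2 * M ^ 2) (s : K) :
    |(D + C δ * F).eval s| ≤
      δ * (|F.eval t| * (1 + |s - t| * M) ^ max D.natDegree F.natDegree) := by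
  have heval : (D + C δ * F).eval t = δ * F.eval t := by simp [hD]
  have hlaguerre : (laguerre (D + C δ * F)).eval t ≤ (D + C δ * F).eval t ^ 2 * M ^ 2 := by
    calc (laguerre (D + C δ * F)).eval t
        = δ ^ 2 * (laguerre F).eval t - δ * (F.eval t * (derivative (derivative D)).eval t) := by
          simp only [laguerre, derivative_add, derivative_C_mul, eval_sub, eval_add, eval_mul,
            eval_pow, eval_C, hD, hD']
          ring
      _ ≤ δ ^ 2 * (F.eval t ^ 2 * M ^ 2) := by
          nlinarith [mul_nonneg hδ.le hFD, mul_le_mul_of_nonneg_left hFM (sq_nonneg δ)]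
      _ = (D + C δ * F).eval t ^ 2 * M ^ 2 := by rw [heval]; ring
  have hdegree : (D + C δ * F).natDegree ≤ max D.natDegree F.natDegree :=
    (natDegree_add_le _ _).trans (max_le_max le_rfl (natDegree_C_mul_le _ _))
  calc |(D + C δ * F).eval s|
      ≤ |(D + C δ * F).eval t| * (1 + |s - t| * M) ^ (D + C δ * F).natDegree :=
        abs_eval_le_of_eval_laguerre_le hsplits
          (heval ▸ mul_ne_zero hδ.ne' hF) hM hlaguerre s
    _ ≤ |(D + C δ * F).eval t| * (1 + |s - t| * M) ^ max D.natDegree F.natDegree := by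
        gcongr
        exact le_add_of_nonneg_right (by positivity)
    _ = δ * (|F.eval t| * (1 + |s - t| * M) ^ max D.natDegree F.natDegree) := by
        rw [heval, abs_mul, abs_of_pos hδ, mul_assoc]

/-- By the Laguerre bound at `t`, the perturbed polynomial `D + δ F` is `O(δ)` at every point. -/
theorem eq_zero_of_splits_pencil_of_double_root {F D : ℝ[X]}
    (h : ∀ c : ℝ, (D + C c * F).Splits) {t : ℝ} (hD : D.eval t = 0)
    (hD' : (derivative D).eval t = 0) (hF : F.eval t ≠ 0) : D = 0 := by
  wlog hFD : 0 ≤ F.eval t * (derivative (derivative D)).eval t generalizing F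
  · refine this (F := -F) (fun c => ?_) (by simpa using hF) ?_
    · simpa using h (-c)
    · rw [eval_neg]
      linarith
  obtain ⟨M, hM, hFM⟩ : ∃ M, 0 ≤ M ∧ (laguerre F).eval t ≤ F.eval t ^ 2 * M ^ 2 := by
    refine ⟨√((laguerre F).eval t) / |F.eval t|, by positivity, ?_⟩
    rw [← mul_pow, ← sq_abs, abs_mul, abs_div, abs_abs, mul_div_cancel₀ _ (abs_pos.2 hF).ne',
      ← Real.sqrt_le_left (abs_nonneg _)]
    exact le_abs_self _
  refine Polynomial.funext fun s => ?_
  set B := |F.eval t| * (1 + |s - t| * M) ^ max D.natDegree F.natDegree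
  have hbound : ∀ δ ∈ Set.Ioi (0 : ℝ), |D.eval s + δ * F.eval s| ≤ δ * B := fun δ hδ => by
    simpa using abs_eval_add_C_mul_le_of_double_root hδ (h δ) hD hD' hF hFD hM hFM s
  have hlim : |D.eval s + 0 * F.eval s| ≤ 0 * B :=
    le_on_closure hbound (by fun_prop) (by fun_prop) (by simp [closure_Ioi])
  simpa using hlim

theorem exists_root_mem_Icc_of_splits_pencil {F G : ℝ[X]} (h : ∀ c : ℝ, (G + C c * F).Splits)
    (hG : G ≠ 0) {u v : ℝ} (huv : u ≤ v) (hdvd : (X - C u) * (X - C v) ∣ G) :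
    ∃ x ∈ Set.Icc u v, F.IsRoot x := by
  by_contra! hF
  obtain ⟨H, hGH⟩ := hdvd
  have hGu : G.eval u = 0 := by simp [hGH]
  have hGv : G.eval v = 0 := by simp [hGH]
  have hFu : F.eval u ≠ 0 := hF u (Set.left_mem_Icc.2 huv)
  rcases huv.eq_or_lt with rfl | huv
  · exact hG (eq_zero_of_splits_pencil_of_double_root h hGu (by simp [hGH]) hFu)
  obtain ⟨t, ht, ht'⟩ := exists_hasDerivAt_eq_zero huv
    (G.continuous.continuousOn.div F.continuous.continuousOn hF) (by simp [hGu, hGv])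
    fun x hx => (G.hasDerivAt x).div (F.hasDerivAt x) (hF x (Set.Ioo_subset_Icc_self hx))
  have hFt : F.eval t ≠ 0 := hF t (Set.Ioo_subset_Icc_self ht)
  obtain ⟨c, hc⟩ : ∃ c, G.eval t + c * F.eval t = 0 := ⟨-(G.eval t / F.eval t), by field_simp; ring⟩
  have hc' : (derivative G).eval t + c * (derivative F).eval t = 0 := by
    have hnum := (div_eq_zero_iff.1 ht').resolve_right (pow_ne_zero 2 hFt)
    refine (mul_eq_zero.1 (?_ : F.eval t * _ = 0)).resolve_left hFt
    linear_combination hnum + (derivative F).eval t * hc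
  have hpencil : G + C c * F = 0 := by
    refine eq_zero_of_splits_pencil_of_double_root (F := F) (t := t) (fun d => ?_)
      (by simpa using hc) (by simpa using hc') hFt
    rw [add_assoc, ← add_mul, ← C_add]
    exact h _
  have hc0 : c = 0 := by simpa [hGu, hFu] using congrArg (eval u) hpencil
  exact hG (by simpa [hc0] using hpencil)

end Pencil

section Dilation

theorem splits_of_natDegree_le_card_roots_add_one {K : Type*} [Field K] {p : K[X]}
    (h : p.natDegree ≤ p.roots.card + 1) : p.Splits := by
  obtain ⟨g, hg, hcard, -⟩ := exists_prod_multiset_X_sub_C_mul p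
  rw [← hg]
  refine Splits.mul (Splits.multisetProd fun f hf => ?_) (Splits.of_natDegree_le_one (by omega))
  obtain ⟨a, -, rfl⟩ := Multiset.mem_map.1 hf
  exact Splits.X_sub_C a

theorem exists_isRoot_mem_Ioo_of_eval_mul_eval_neg {p : ℝ[X]} {a b : ℝ} (hab : a ≤ b)
    (h : p.eval a * p.eval b < 0) : ∃ x ∈ Set.Ioo a b, p.IsRoot x := by
  rcases mul_neg_iff.1 h with ⟨ha, hb⟩ | ⟨ha, hb⟩
  · exact intermediate_value_Ioo' hab p.continuous.continuousOn ⟨hb, ha⟩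
  · exact intermediate_value_Ioo hab p.continuous.continuousOn ⟨ha, hb⟩

theorem splits_of_sign_changes {p : ℝ[X]} {m : ℕ} (hp : p.natDegree ≤ m + 1)
    {x : Fin (m + 1) → ℝ} (hx : Monotone x)
    (hsign : ∀ j : Fin m, p.eval (x j.castSucc) * p.eval (x j.succ) < 0) : p.Splits := by
  rcases eq_or_ne p 0 with rfl | hp0
  · exact Splits.zero
  choose y hy hroot using fun j : Fin m =>
    exists_isRoot_mem_Ioo_of_eval_mul_eval_neg (hx j.castSucc_lt_succ.le) (hsign j)
  have hmono : StrictMono y := fun j k hjk =>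
    (hy j).2.trans ((hx (Fin.succ_le_castSucc_iff.2 hjk)).trans_lt (hy k).1)
  have hcard : m ≤ p.roots.card :=
    calc m = (Finset.univ.image y).card := by
          rw [Finset.card_image_of_injective _ hmono.injective, Finset.card_fin]
      _ ≤ p.roots.toFinset.card := Finset.card_le_card <| by
          simpa [Finset.subset_iff, hp0] using hroot
      _ ≤ p.roots.card := Multiset.toFinset_card_le _
  exact splits_of_natDegree_le_card_roots_add_one (by omega)

theorem eval_mul_eval_prod_X_sub_C_neg {ι K : Type*} [Fintype ι] [CommRing K] [LinearOrder K]
    [IsStrictOrderedRing K] {e : ι → K} {a b : K} (k : ι) (hak : a < e k) (hkb : e k < b)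
    (h : ∀ i ≠ k, e i < a ∨ b < e i) :
    (∏ i, (X - C (e i))).eval a * (∏ i, (X - C (e i))).eval b < 0 := by
  classical
  simp only [eval_prod, ← Finset.prod_mul_distrib, eval_sub, eval_X, eval_C]
  rw [← Finset.mul_prod_erase _ _ (Finset.mem_univ k)]
  refine mul_neg_of_neg_of_pos
    (mul_neg_of_neg_of_pos (sub_neg.2 hak) (sub_pos.2 hkb)) (Finset.prod_pos fun i hi => ?_)
  have hab := hak.trans hkb
  rcases h i (Finset.ne_of_mem_erase hi) with hia | hbi
  · exact mul_pos (sub_pos.2 hia) (sub_pos.2 (hia.trans hab))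
  · exact mul_pos_of_neg_of_neg (sub_neg.2 (hab.trans hbi)) (sub_neg.2 hbi)

/-- The polynomial `P(x) + c P(r x)`, a member of the pencil spanned by `P` and its dilate. The
hyperbolicity of these pencils is what encodes the logarithmic mesh of `P`. -/
noncomputable def dilationPencil (P : ℝ[X]) (r c : ℝ) : ℝ[X] := P + C c * P.comp (C r * X)

variable {n : ℕ} {e : Fin n → ℝ}

theorem splits_dilationPencil_of_pos {r : ℝ} (hr : 1 < r) (hpos : ∀ i, 0 < e i)
    (hsep : ∀ i j, i < j → r * e i < e j) (c : ℝ) :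
    (dilationPencil (∏ i, (X - C (e i))) r c).Splits := by
  rw [dilationPencil]
  rcases eq_or_ne c 0 with rfl | hc
  · simp only [C_0, zero_mul, add_zero]
    exact Splits.prod fun i _ => Splits.X_sub_C (e i)
  set P := ∏ i, (X - C (e i)) with hP
  have hPdeg : P.natDegree = n := by simp [hP, natDegree_prod_of_monic, monic_X_sub_C]
  have hdeg : (P + C c * P.comp (C r * X)).natDegree ≤ n := by
    refine natDegree_add_le_of_degree_le hPdeg.le ((natDegree_C_mul_le _ _).trans ?_)
    rw [natDegree_comp, hPdeg, natDegree_C_mul_X _ (by positivity), mul_one]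
  obtain _ | m := n
  · exact Splits.of_natDegree_eq_zero (by omega)
  have hself : ∀ i, e i < r * e i := fun i => lt_mul_of_one_lt_left (hpos i) hr
  have hmono : StrictMono e := fun i j hij => (hself i).trans (hsep i j hij)
  refine splits_of_sign_changes hdeg hmono.monotone fun j => ?_
  have hval : ∀ i, (P + C c * P.comp (C r * X)).eval (e i) = c * P.eval (r * e i) := fun i => by
    have hroot : P.eval (e i) = 0 := by
      rw [hP, eval_prod]
      exact Finset.prod_eq_zero (Finset.mem_univ i) (by simp)
    simp [hroot]
  have hneg : P.eval (r * e j.castSucc) * P.eval (r * e j.succ) < 0 := by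
    refine eval_mul_eval_prod_X_sub_C_neg j.succ (hsep _ _ j.castSucc_lt_succ) (hself _)
      fun i hi => ?_
    rcases hi.lt_or_gt with hlt | hgt
    · exact .inl ((hmono.monotone (Fin.le_castSucc_iff.2 hlt)).trans_lt (hself _))
    · exact .inr (hsep _ _ hgt)
  rw [hval, hval, mul_mul_mul_comm]
  exact mul_neg_of_pos_of_neg (mul_self_pos.2 hc) hneg

theorem splits_dilationPencil_of_nonneg {r : ℝ} (hr : 1 < r) (hnonneg : ∀ i, 0 ≤ e i)
    (hmono : Monotone e) (hsep : ∀ i j, i < j → e i ≠ 0 → r * e i < e j) (c : ℝ) :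
    (dilationPencil (∏ i, (X - C (e i))) r c).Splits := by
  induction n generalizing c with
  | zero => exact splits_dilationPencil_of_pos hr (fun i => i.elim0) (fun i => i.elim0) c
  | succ n ih =>
    rcases (hnonneg 0).eq_or_lt with hzero | hpos
    · have hfactor : ∀ R, dilationPencil (X * R) r c = X * dilationPencil R r (c * r) := fun R => by
        simp only [dilationPencil, mul_comp, X_comp, C_mul]
        ring
      rw [Fin.prod_univ_succ, ← hzero, C_0, sub_zero, hfactor]
      exact Splits.X.mul <| ih (fun i => hnonneg _)
        (hmono.comp (Fin.strictMono_succ).monotone)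
        (fun i j hij => hsep _ _ (Fin.succ_lt_succ_iff.2 hij)) _
    · have hpos : ∀ i, 0 < e i := fun i => hpos.trans_le (hmono (Fin.zero_le i))
      exact splits_dilationPencil_of_pos hr hpos
        (fun i j hij => hsep i j hij (hpos i).ne') c

theorem exists_mem_Icc_of_splits_dilationPencil {r : ℝ} (hr : 0 ≤ r)
    (h : ∀ c, (dilationPencil (∏ i, (X - C (e i))) r c).Splits) {i j : Fin n} (hij : i ≠ j)
    (hle : e i ≤ e j) : ∃ k, e k ∈ Set.Icc (r * e i) (r * e j) := by
  have hdvd : (X - C (e i)) * (X - C (e j)) ∣ ∏ k, (X - C (e k)) := by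
    rw [← Finset.prod_pair (f := fun k => X - C (e k)) hij]
    exact Finset.prod_dvd_prod_of_subset _ _ _ (Finset.subset_univ _)
  obtain ⟨x, ⟨hix, hxj⟩, hroot⟩ := exists_root_mem_Icc_of_splits_pencil h
    (Finset.prod_ne_zero_iff.2 fun k _ => X_sub_C_ne_zero _) hle hdvd
  obtain ⟨k, hk⟩ : ∃ k, r * x - e k = 0 := by
    simpa [IsRoot, eval_comp, eval_prod, Finset.prod_eq_zero_iff] using hroot
  rw [sub_eq_zero] at hk
  exact ⟨k, hk ▸ mul_le_mul_of_nonneg_left hix hr, hk ▸ mul_le_mul_of_nonneg_left hxj hr⟩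

theorem mul_le_of_splits_dilationPencil {q : ℝ} (hnonneg : ∀ i, 0 ≤ e i) (hmono : Monotone e)
    (h : ∀ r ∈ Set.Ioo 1 q, ∀ c, (dilationPencil (∏ i, (X - C (e i))) r c).Splits)
    (i j : Fin n) (hij : i < j) (hi : e i ≠ 0) : q * e i ≤ e j := by
  induction j using WellFoundedGT.induction generalizing i with
  | ind j ih =>
  by_contra! hlt
  have hipos : 0 < e i := (hnonneg i).lt_of_ne' hi
  have hle : e i ≤ e j := hmono hij.le
  obtain ⟨r, hjr, hrq⟩ := exists_between ((div_lt_iff₀ hipos).2 hlt)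
  have hr : 1 < r := ((one_le_div hipos).2 hle).trans_lt hjr
  obtain ⟨k, hik, hkj⟩ := exists_mem_Icc_of_splits_dilationPencil (zero_le_one.trans hr.le)
    (h r ⟨hr, hrq⟩) hij.ne hle
  have hjk : j < k := hmono.reflect_lt (((div_lt_iff₀ hipos).1 hjr).trans_le hik)
  have hjpos : 0 < e j := hipos.trans_le hle
  have hqk : q * e j ≤ e k := ih k hjk j hjk hjpos.ne'
  exact (mul_lt_mul_of_pos_right hrq hjpos).not_ge (hqk.trans hkj)

end Dilation

section MultiplierSequence

/-- The signs of `γ` are those of a geometric progression with nonzero ratio: up to a global sign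
and up to alternation, the terms of `γ` are nonnegative. -/
def HasGeometricSigns (γ : ℕ → ℝ) : Prop :=
  ∃ a s : ℝ, a ≠ 0 ∧ s ≠ 0 ∧ ∀ i, 0 ≤ a * s ^ i * γ i

/-- The nonzero real roots of `P` all have the same sign. -/
def HasOneSignedRoots (P : ℝ[X]) : Prop :=
  (∀ x ∈ P.roots, 0 ≤ x) ∨ ∀ x ∈ P.roots, x ≤ 0

theorem HasGeometricSigns.mul {γ δ : ℕ → ℝ} (hγ : HasGeometricSigns γ)
    (hδ : HasGeometricSigns δ) : HasGeometricSigns fun n => γ n * δ n := by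
  obtain ⟨a, s, ha, hs, hγ⟩ := hγ
  obtain ⟨b, t, hb, ht, hδ⟩ := hδ
  refine ⟨a * b, s * t, mul_ne_zero ha hb, mul_ne_zero hs ht, fun i => ?_⟩
  calc 0 ≤ a * s ^ i * γ i * (b * t ^ i * δ i) := mul_nonneg (hγ i) (hδ i)
    _ = a * b * (s * t) ^ i * (γ i * δ i) := by ring

theorem HasGeometricSigns.hasOneSignedRoots {P : ℝ[X]} (hP : HasGeometricSigns P.coeff) :
    HasOneSignedRoots P := by
  obtain ⟨a, s, ha, hs, hcoeff⟩ := hP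
  have hsign : ∀ x ∈ P.roots, s * x ≤ 0 := by
    intro x hx
    by_contra! hsx
    have hterm : ∀ i, 0 ≤ a * (P.coeff i * x ^ i) := fun i => by
      have hxs : 0 ≤ x / s := (div_pos_iff.2 (mul_pos_iff.1 (mul_comm s x ▸ hsx))).le
      calc 0 ≤ a * s ^ i * P.coeff i * (x / s) ^ i := mul_nonneg (hcoeff i) (pow_nonneg hxs i)
        _ = a * (P.coeff i * x ^ i) := by rw [div_pow]; field_simp
    have hsum : ∑ i ∈ Finset.range (P.natDegree + 1), a * (P.coeff i * x ^ i) = 0 := by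
      rw [← Finset.mul_sum, ← eval_eq_sum_range, (isRoot_of_mem_roots hx).eq_zero, mul_zero]
    have hlead := (Finset.sum_eq_zero_iff_of_nonneg fun i _ => hterm i).1 hsum P.natDegree
      (Finset.self_mem_range_succ _)
    have hx0 : x ≠ 0 := right_ne_zero_of_mul hsx.ne'
    have hP0 : P.leadingCoeff ≠ 0 := leadingCoeff_ne_zero.2 (ne_zero_of_mem_roots hx)
    exact mul_ne_zero ha (mul_ne_zero hP0 (pow_ne_zero _ hx0)) hlead
  rcases hs.lt_or_gt with hneg | hpos
  · exact .inl fun x hx => nonneg_of_mul_nonpos_right (hsign x hx) hneg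
  · exact .inr fun x hx => nonpos_of_mul_nonpos_right (hsign x hx) hpos

theorem coeff_diagonalOperator (α : ℕ → ℝ) (p : ℝ[X]) (i : ℕ) :
    (diagonalOperator α p).coeff i = α i * p.coeff i := by
  induction p using Polynomial.induction_on' with
  | add p q hp hq => rw [map_add, coeff_add, hp, hq, coeff_add, mul_add]
  | monomial n a =>
    rw [diagonalOperator, lsum_apply, sum_monomial_index _ _ (by simp)]
    by_cases h : n = i
    · subst h; simp
    · simp [coeff_monomial, h]

theorem diagonalOperator_comp_C_mul_X (α : ℕ → ℝ) (p : ℝ[X]) (r : ℝ) :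
    diagonalOperator α (p.comp (C r * X)) = (diagonalOperator α p).comp (C r * X) := by
  ext i
  simp only [coeff_diagonalOperator, comp_C_mul_X_coeff, mul_assoc]

theorem diagonalOperator_dilationPencil (α : ℕ → ℝ) (p : ℝ[X]) (r c : ℝ) :
    diagonalOperator α (dilationPencil p r c) = dilationPencil (diagonalOperator α p) r c := by
  rw [dilationPencil, map_add, C_mul' c, map_smul, diagonalOperator_comp_C_mul_X, dilationPencil,
    C_mul' c]

theorem diagonalOperator_diagonalOperator (α β : ℕ → ℝ) (p : ℝ[X]) :
    diagonalOperator β (diagonalOperator α p) = diagonalOperator (fun n => α n * β n) p := by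
  ext i
  simp only [coeff_diagonalOperator]
  ring

theorem finitePoly_truncation (α : ℕ → ℝ) (k : ℕ) :
    finitePoly (truncation α k) = diagonalOperator α ((1 + X) ^ k) := by
  ext i
  simp only [finitePoly, truncation, finsetSum_coeff, coeff_C_mul, coeff_X_pow,
    coeff_diagonalOperator, coeff_one_add_X_pow, mul_ite, mul_one, mul_zero]
  rw [Fin.sum_univ_eq_sum_range (fun j => if i = j then (k.choose j : ℝ) * α j else 0),
    Finset.sum_ite_eq]
  split_ifs with hi
  · exact mul_comm _ _
  · rw [Nat.choose_eq_zero_of_lt (by simpa using hi), Nat.cast_zero, mul_zero]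

theorem splits_one_add_X_pow {R : Type*} [CommSemiring R] (k : ℕ) :
    ((1 + X : R[X]) ^ k).Splits := by
  rw [add_comm, ← C_1]
  exact (Splits.X_add_C 1).pow k

namespace IsMultiplierSequence

variable {α : ℕ → ℝ}

theorem splits_finitePoly (hα : IsMultiplierSequence α) (k : ℕ) :
    (finitePoly (truncation α k)).Splits := by
  rw [finitePoly_truncation]
  exact hα _ (splits_one_add_X_pow k)

theorem shift (hα : IsMultiplierSequence α) (n : ℕ) :
    IsMultiplierSequence fun i => α (n + i) := by
  induction n with
  | zero => simpa using hα
  | succ n ih =>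
    intro p hp
    have hX : diagonalOperator (fun i => α (n + i)) (X * p) =
        X * diagonalOperator (fun i => α (n + 1 + i)) p := by
      ext i
      cases i with
      | zero => simp [coeff_diagonalOperator]
      | succ i => simp [coeff_diagonalOperator, coeff_X_mul, add_assoc, add_comm 1 i]
    exact splits_X_mul.1 (hX ▸ ih _ (Splits.X.mul hp))

theorem zero_mul_two_nonneg (hα : IsMultiplierSequence α) : 0 ≤ α 0 * α 2 := by
  by_contra! hneg
  have hsplits : (1 - X ^ 2 : ℝ[X]).Splits := by
    rw [show (1 - X ^ 2 : ℝ[X]) = (X + C 1) * -(X - C 1) by rw [C_1]; ring]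
    exact (Splits.X_add_C 1).mul (Splits.X_sub_C 1).neg
  set p := diagonalOperator α (1 - X ^ 2) with hp
  have h0 : p.coeff 0 = α 0 := by simp [hp, coeff_diagonalOperator]
  have h1 : p.coeff 1 = 0 := by simp [hp, coeff_diagonalOperator, coeff_one, coeff_X_pow]
  have h2 : p.coeff 2 = -α 2 := by simp [hp, coeff_diagonalOperator, coeff_one]
  have hdeg : p.natDegree = 0 := by
    refine natDegree_eq_zero_of_coeff_zero_mul_coeff_two_nonneg (hα _ hsplits) ?_ h1 ?_
    · rw [h0]
      exact left_ne_zero_of_mul hneg.ne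
    · rw [h0, h2]
      linarith
  have htwo : p.coeff 2 = 0 := coeff_eq_zero_of_natDegree_lt (by omega)
  exact right_ne_zero_of_mul hneg.ne (neg_eq_zero.1 (h2.symm.trans htwo))

theorem eq_zero_of_one_eq_zero (hα : IsMultiplierSequence α) (h0 : α 0 ≠ 0) (h1 : α 1 = 0)
    {k : ℕ} (hk : k ≠ 0) : α k = 0 := by
  set p := diagonalOperator α ((1 + X) ^ k)
  have hcoeff : ∀ i, p.coeff i = α i * k.choose i := fun i => by
    rw [coeff_diagonalOperator, coeff_one_add_X_pow]
  have hdeg : p.natDegree = 0 := by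
    refine natDegree_eq_zero_of_coeff_zero_mul_coeff_two_nonneg (hα _ (splits_one_add_X_pow k))
      (by simpa [hcoeff] using h0) (by simp [hcoeff, h1]) ?_
    calc 0 ≤ α 0 * α 2 * k.choose 2 := mul_nonneg hα.zero_mul_two_nonneg (Nat.cast_nonneg _)
      _ = p.coeff 0 * p.coeff 2 := by simp [hcoeff, mul_assoc]
  have hk' := coeff_eq_zero_of_natDegree_lt (p := p) (n := k) (by omega)
  simpa [hcoeff] using hk'

theorem eq_zero_of_le (hα : IsMultiplierSequence α) (h0 : α 0 ≠ 0) {i k : ℕ} (hik : i ≤ k)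
    (hi : α i = 0) : α k = 0 := by
  induction i generalizing k with
  | zero => exact absurd hi h0
  | succ i ih =>
    by_cases hi' : α i = 0
    · exact ih (by omega) hi'
    · have := (hα.shift i).eq_zero_of_one_eq_zero (k := k - i) hi' hi (by omega)
      rwa [Nat.add_sub_cancel' (by omega)] at this

theorem exists_zero_mul_pow_mul_nonneg (hα : IsMultiplierSequence α) (h0 : α 0 ≠ 0) :
    ∃ s ≠ 0, ∀ i, 0 ≤ α 0 * s ^ i * α i := by
  by_cases h1 : α 1 = 0
  · refine ⟨1, one_ne_zero, fun i => ?_⟩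
    rcases eq_or_ne i 0 with rfl | hi
    · simpa using mul_self_nonneg (α 0)
    · simp [hα.eq_zero_of_one_eq_zero h0 h1 hi]
  set s := α 0 * α 1
  have hs0 : s ≠ 0 := mul_ne_zero h0 h1
  refine ⟨s, hs0, fun i => ?_⟩
  induction i using Nat.twoStepInduction with
  | zero => simpa using mul_self_nonneg (α 0)
  | one => rw [pow_one, mul_right_comm]; exact mul_self_nonneg s
  | more i ih _ =>
    by_cases hi : α i = 0
    · simp [hα.eq_zero_of_le h0 (show i ≤ i + 2 by omega) hi]
    · have htwo : 0 ≤ α i * α (i + 2) := (hα.shift i).zero_mul_two_nonneg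
      have hpos : 0 < α 0 * s ^ i * α i := ih.lt_of_ne' (by positivity)
      refine nonneg_of_mul_nonneg_right ?_ hpos
      calc 0 ≤ (α 0 * s ^ (i + 1)) ^ 2 * (α i * α (i + 2)) := by positivity
        _ = α 0 * s ^ i * α i * (α 0 * s ^ (i + 2) * α (i + 2)) := by ring

theorem hasGeometricSigns (hα : IsMultiplierSequence α) : HasGeometricSigns α := by
  classical
  by_cases h : ∃ n, α n ≠ 0
  · set n := Nat.find h
    have hn : α n ≠ 0 := Nat.find_spec h
    obtain ⟨s, hs, hshift⟩ := (hα.shift n).exists_zero_mul_pow_mul_nonneg hn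
    refine ⟨α n * s ^ n, s, mul_ne_zero hn (pow_ne_zero n hs), hs, fun i => ?_⟩
    rcases lt_or_ge i n with hi | hi
    · simp [not_not.1 (Nat.find_min h hi)]
    · obtain ⟨j, rfl⟩ := Nat.exists_eq_add_of_le hi
      calc 0 ≤ (s ^ n) ^ 2 * (α n * s ^ j * α (n + j)) := mul_nonneg (sq_nonneg _) (hshift j)
        _ = α n * s ^ n * s ^ (n + j) * α (n + j) := by ring
  · push Not at h
    exact ⟨1, 1, one_ne_zero, one_ne_zero, fun i => by simp [h i]⟩

end IsMultiplierSequence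

end MultiplierSequence


section LogarithmicMesh

theorem coe_le_minQuotient_iff {L : List ℝ} (hnonneg : ∀ i, 0 ≤ L.get i) (hmono : Monotone L.get)
    {q : ℝ} :
    (q : EReal) ≤ minQuotient L ↔ ∀ i j, i < j → L.get i ≠ 0 → q * L.get i ≤ L.get j := by
  simp only [minQuotient, le_iInf_iff, EReal.coe_le_coe_iff]
  constructor
  · intro h i j hij hi
    have hnext : (i : ℕ) + 1 < L.length := by omega
    have hq : q * L.get i ≤ L.get ⟨i + 1, hnext⟩ :=
      (le_div_iff₀ ((hnonneg i).lt_of_ne' hi)).1 (h i hnext hi)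
    exact hq.trans (hmono (Fin.le_def.2 hij))
  · intro h j hj hj0
    exact (le_div_iff₀ ((hnonneg ⟨j, by omega⟩).lt_of_ne' hj0)).2
      (h ⟨j, by omega⟩ ⟨j + 1, hj⟩ (Fin.lt_def.2 j.lt_succ_self) hj0)

theorem absRoots_get_nonneg (P : ℝ[X]) (i : Fin (absRoots P).length) : 0 ≤ (absRoots P).get i := by
  obtain ⟨x, -, hx⟩ := Multiset.mem_map.1 ((Multiset.mem_sort _).1 ((absRoots P).get_mem i))
  exact hx ▸ abs_nonneg x

theorem monotone_absRoots_get (P : ℝ[X]) : Monotone (absRoots P).get :=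
  (Multiset.pairwise_sort _ (· ≤ ·)).sortedLE.monotone_get

theorem eq_C_mul_prod_absRoots_get {P : ℝ[X]} (hP : P.Splits) (hroots : ∀ x ∈ P.roots, 0 ≤ x) :
    P = C P.leadingCoeff * ∏ i, (X - C ((absRoots P).get i)) := by
  have habs : (absRoots P : Multiset ℝ) = P.roots := by
    rw [absRoots, Multiset.sort_eq]
    exact (Multiset.map_congr rfl fun x hx => abs_of_nonneg (hroots x hx)).trans
      (Multiset.map_id' _)
  calc P = C P.leadingCoeff * (P.roots.map (X - C ·)).prod := hP.eq_prod_roots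
    _ = C P.leadingCoeff * ∏ i, (X - C ((absRoots P).get i)) := by
      rw [← habs, Multiset.map_coe, Multiset.prod_coe]
      exact congrArg _ (Fin.prod_univ_fun_getElem (absRoots P) (X - C ·)).symm

theorem dilationPencil_C_mul (a : ℝ) (P : ℝ[X]) (r c : ℝ) :
    dilationPencil (C a * P) r c = C a * dilationPencil P r c := by
  simp only [dilationPencil, mul_comp, C_comp]
  ring

theorem dilationPencil_comp_neg_X (P : ℝ[X]) (r c : ℝ) :
    dilationPencil (P.comp (-X)) r c = (dilationPencil P r c).comp (-X) := by
  simp [dilationPencil, comp_assoc]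

theorem lmesh_comp_neg_X (P : ℝ[X]) : lmesh (P.comp (-X)) = lmesh P := by
  simp [lmesh, absRoots, roots_comp_neg_X]

theorem splits_comp_neg_X_iff {P : ℝ[X]} : (P.comp (-X)).Splits ↔ P.Splits :=
  ⟨fun h => comp_neg_X_comp_neg_X P ▸ h.comp_neg_X, Splits.comp_neg_X⟩

theorem coe_le_lmesh_iff_of_roots_nonneg {P : ℝ[X]} (hP : P.Splits) (hroots : ∀ x ∈ P.roots, 0 ≤ x)
    {q : ℝ} :
    (q : EReal) ≤ lmesh P ↔ ∀ r ∈ Set.Ioo 1 q, ∀ c, (dilationPencil P r c).Splits := by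
  rcases eq_or_ne P 0 with rfl | hP0
  · simp [lmesh, absRoots, minQuotient, dilationPencil]
  have hnonneg := absRoots_get_nonneg P
  have hmono := monotone_absRoots_get P
  have hlead : P.leadingCoeff ≠ 0 := leadingCoeff_ne_zero.2 hP0
  have hfactor : ∀ r c, (dilationPencil P r c).Splits ↔
      (dilationPencil (∏ i, (X - C ((absRoots P).get i))) r c).Splits := fun r c => by
    conv_lhs => rw [eq_C_mul_prod_absRoots_get hP hroots, dilationPencil_C_mul]
    exact ⟨fun h => by simpa [← mul_assoc, ← C_mul, hlead] using h.C_mul P.leadingCoeff⁻¹,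
      fun h => h.C_mul _⟩
  simp only [hfactor]
  rw [lmesh, coe_le_minQuotient_iff hnonneg hmono]
  refine ⟨fun h r hr c => ?_, mul_le_of_splits_dilationPencil hnonneg hmono⟩
  refine splits_dilationPencil_of_nonneg hr.1 hnonneg hmono (fun i j hij hi => ?_) c
  exact (mul_lt_mul_of_pos_right hr.2 ((hnonneg i).lt_of_ne' hi)).trans_le (h i j hij hi)

theorem coe_le_lmesh_iff {P : ℝ[X]} (hP : P.Splits) (hroots : HasOneSignedRoots P) {q : ℝ} :
    (q : EReal) ≤ lmesh P ↔ ∀ r ∈ Set.Ioo 1 q, ∀ c, (dilationPencil P r c).Splits := by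
  rcases hroots with hnonneg | hnonpos
  · exact coe_le_lmesh_iff_of_roots_nonneg hP hnonneg
  · have hneg : ∀ x ∈ (P.comp (-X)).roots, 0 ≤ x := by
      simpa only [roots_comp_neg_X, Multiset.forall_mem_map_iff, neg_nonneg] using hnonpos
    simpa only [lmesh_comp_neg_X, dilationPencil_comp_neg_X, splits_comp_neg_X_iff] using
      coe_le_lmesh_iff_of_roots_nonneg hP.comp_neg_X hneg (q := q)

theorem lmesh_le_lmesh_diagonalOperator {β : ℕ → ℝ} (hβ : IsMultiplierSequence β) {P : ℝ[X]}
    (hP : P.Splits) (hsigns : HasGeometricSigns P.coeff) :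
    lmesh P ≤ lmesh (diagonalOperator β P) := by
  have hsigns' : HasGeometricSigns (diagonalOperator β P).coeff := by
    simpa only [← coeff_diagonalOperator] using hβ.hasGeometricSigns.mul hsigns
  refine EReal.ge_of_forall_gt_iff_ge.1 fun q hq => ?_
  refine (coe_le_lmesh_iff (hβ P hP) hsigns'.hasOneSignedRoots).2 fun r hr c => ?_
  rw [← diagonalOperator_dilationPencil]
  exact hβ _ ((coe_le_lmesh_iff hP hsigns.hasOneSignedRoots).1 hq.le r hr c)

theorem IsMultiplierSequence.hasGeometricSigns_coeff_finitePoly {α : ℕ → ℝ}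
    (hα : IsMultiplierSequence α) (k : ℕ) :
    HasGeometricSigns (finitePoly (truncation α k)).coeff := by
  have hchoose : HasGeometricSigns ((1 + X : ℝ[X]) ^ k).coeff :=
    ⟨1, 1, one_ne_zero, one_ne_zero, fun i => by simp [coeff_one_add_X_pow]⟩
  simpa only [finitePoly_truncation, ← coeff_diagonalOperator] using
    hα.hasGeometricSigns.mul hchoose

theorem lmeshSeq_le_lmeshSeq_mul {α β : ℕ → ℝ} (hα : IsMultiplierSequence α)
    (hβ : IsMultiplierSequence β) : lmeshSeq α ≤ lmeshSeq fun n => α n * β n := by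
  refine iInf_mono fun k => ?_
  calc lmesh (finitePoly (truncation α k))
      ≤ lmesh (diagonalOperator β (finitePoly (truncation α k))) :=
        lmesh_le_lmesh_diagonalOperator hβ (hα.splits_finitePoly k)
          (hα.hasGeometricSigns_coeff_finitePoly k)
    _ = lmesh (finitePoly (truncation (fun n => α n * β n) k)) := by
        rw [finitePoly_truncation, diagonalOperator_diagonalOperator, ← finitePoly_truncation]

end LogarithmicMesh
end LogMesh

theorem mainTheorem4 (A B : ℕ → ℝ)
    (hA : LogMesh.IsMultiplierSequence A) (hB : LogMesh.IsMultiplierSequence B) :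
    max (LogMesh.lmeshSeq A) (LogMesh.lmeshSeq B) ≤ LogMesh.lmeshSeq (fun n => A n * B n) := by
  refine max_le (LogMesh.lmeshSeq_le_lmeshSeq_mul hA hB) ?_
  simpa only [mul_comm] using LogMesh.lmeshSeq_le_lmeshSeq_mul hB hA
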